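/- Let $S^2$ be the unit sphere of $\mathbb{R}^3$ with the spherical (great-circle) distance. A subset of $S^2$ is convex if it contains no pair of antipodes and, together with any two of its points, contains the shorter great-circle arc joining them; a spherical convex body is a closed convex set with non-empty interior. The hemisphere with center $m$ is the set of points at distance at most $\pi/2$ from $m$; it supports a convex body $C$ if it contains $C$ and its bounding great circle passes through a boundary point of $C$. A lune is an intersection $L=G\cap H$ of two hemispheres that are different and not opposite; it is bounded by two semicircles, $G/H$ (the part of the great circle bounding $G$ that lies in $H$) and $H/G$, and its thickness $\Delta(L)$ is the distance between the centers of these two semicircles. (The center of a semicircle is the point $c$ of its great circle such that the semicircle consists of the points of this great circle at distance at most $\pi/2$ from $c$.) For a hemisphere $K$ supporting a convex body $C$, ${\rm width}_K(C)$ is the minimum thickness of the lunes $K\cap K^*$ over the hemispheres $K^*$ supporting $C$ that are different from and not opposite to $K$. The thickness $\Delta(C)$ is the minimum of ${\rm width}_K(C)$ over all hemispheres $K$ supporting $C$, and $C$ is of constant width if ${\rm width}_K(C)$ is the same for all hemispheres $K$ supporting $C$. Theorem. Let $W\subset S^2$ be a spherical convex body of constant width. For every boundary point $p$ of $W$ there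 exists a lune $L\supset W$ with $\Delta(L)=\Delta(W)$ such that $p$ is the center of one of the two semicircles bounding $L$. -/

import Mathlib

open scoped RealInnerProductSpace

noncomputable section

namespace SphericalConvex

/-- Three-dimensional Euclidean space. -/
abbrev E3 : Type := EuclideanSpace ℝ (Fin 3)

/-- The unit sphere `S²`, with the topology induced from Euclidean space. -/
abbrev S2 : Type := Metric.sphere (0 : E3) 1

/-- The spherical distance: the length of the shorter great-circle arc joining the two points. -/
def sdist (a b : S2) : ℝ := InnerProductGeometry.angle (a : E3) (b : E3)

/-- The spherical arc joining `a` and `b` (for `b ≠ -a`): the points of `S²` that are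
nonnegative combinations of `a` and `b`, which is the shorter part of the great circle
through `a` and `b`. -/
def arc (a b : S2) : Set S2 :=
  {x | ∃ s t : ℝ, 0 ≤ s ∧ 0 ≤ t ∧ (x : E3) = s • (a : E3) + t • (b : E3)}

/-- A subset of `S²` is convex if it contains no pair of antipodes and contains, with any two
of its points, the arc joining them. -/
def IsConvex (C : Set S2) : Prop :=
  (∀ a ∈ C, -a ∉ C) ∧ ∀ a ∈ C, ∀ b ∈ C, arc a b ⊆ C

/-- A spherical convex body: a closed convex set with nonempty interior (in `S²`). -/
def IsConvexBody (C : Set S2) : Prop :=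
  IsClosed C ∧ IsConvex C ∧ (interior C).Nonempty

/-- The hemisphere with center `m`. -/
def hemisphere (m : S2) : Set S2 := {x | sdist m x ≤ Real.pi / 2}

/-- The great circle bounding the hemisphere with center `m`. -/
def greatCircle (m : S2) : Set S2 := {x | ⟪(m : E3), (x : E3)⟫ = 0}

/-- The hemisphere with center `m` supports `C` at the boundary point `p` of `C`. -/
def SupportsAt (m : S2) (C : Set S2) (p : S2) : Prop :=
  p ∈ frontier C ∧ C ⊆ hemisphere m ∧ p ∈ greatCircle m

/-- The hemisphere with center `m` supports `C` (at some boundary point of `C`). -/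
def Supports (m : S2) (C : Set S2) : Prop := ∃ p, SupportsAt m C p

/-- `Q` is a semicircle with center `c`: the set of the points of a great circle through `c`
whose distance from `c` is at most `π / 2`. -/
def IsSemicircleCenter (c : S2) (Q : Set S2) : Prop :=
  ∃ m : S2, c ∈ greatCircle m ∧ Q = {x | x ∈ greatCircle m ∧ sdist c x ≤ Real.pi / 2}

/-- A lune, given by the centers `g` and `h` of two different and not opposite hemispheres
`G` and `H`. -/
structure Lune where
  /-- the center of the hemisphere `G` -/
  g : S2
  /-- the center of the hemisphere `H` -/
  h : S2
  ne : g ≠ h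
  ne_neg : g ≠ -h

namespace Lune

/-- The lune as a set of points: `G ∩ H`. -/
def carrier (L : Lune) : Set S2 := hemisphere L.g ∩ hemisphere L.h

/-- The same lune, with the two hemispheres interchanged. -/
def swap (L : Lune) : Lune where
  g := L.h
  h := L.g
  ne := L.ne.symm
  ne_neg := fun e => L.ne_neg (by rw [e, neg_neg])

/-- The semicircle `G/H`, the part of the boundary of the lune that lies on the great circle
bounding `G`. The semicircle `H/G` is `L.swap.semicircle`. -/
def semicircle (L : Lune) : Set S2 := greatCircle L.g ∩ hemisphere L.h

/-- The component of the center of `H` orthogonal to the center of `G`. -/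
def dir (L : Lune) : E3 := (L.h : E3) - ⟪(L.g : E3), (L.h : E3)⟫ • (L.g : E3)

end Lune

lemma norm_coe (x : S2) : ‖(x : E3)‖ = 1 := by simpa using x.2

lemma inner_self_coe (x : S2) : ⟪(x : E3), (x : E3)⟫ = 1 := by
  rw [real_inner_self_eq_norm_sq, norm_coe, one_pow]

lemma sdist_le_pi_div_two_iff (a b : S2) :
    sdist a b ≤ Real.pi / 2 ↔ 0 ≤ ⟪(a : E3), (b : E3)⟫ := by
  unfold sdist InnerProductGeometry.angle
  rw [Real.arccos_le_pi_div_two, norm_coe, norm_coe]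
  simp

lemma Lune.dir_ne_zero (L : Lune) : L.dir ≠ 0 := by
  intro h0
  have e : (L.h : E3) = ⟪(L.g : E3), (L.h : E3)⟫ • (L.g : E3) := sub_eq_zero.mp h0
  set c : ℝ := ⟪(L.g : E3), (L.h : E3)⟫ with hc
  have hn : |c| = 1 := by
    have := congrArg norm e
    rw [norm_smul, norm_coe, norm_coe, mul_one, Real.norm_eq_abs] at this
    exact this.symm
  rcases (abs_eq zero_le_one).mp hn with h1 | h1
  · exact L.ne (Subtype.ext (by rw [e, h1, one_smul]))
  · exact L.ne_neg (Subtype.ext (by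
      change (L.g : E3) = -(L.h : E3)
      rw [e, h1, neg_one_smul, neg_neg]))

/-- The center of the semicircle `G/H` (this is confirmed by the lemma
`Lune.isSemicircleCenter_iff`). The center of `H/G` is `L.swap.center`. -/
def Lune.center (L : Lune) : S2 :=
  ⟨‖L.dir‖⁻¹ • L.dir, by
    rw [mem_sphere_zero_iff_norm, norm_smul, norm_inv, norm_norm,
      inv_mul_cancel₀ (norm_ne_zero_iff.mpr L.dir_ne_zero)]⟩

lemma Lune.center_mem (L : Lune) : L.center ∈ greatCircle L.g := by
  change ⟪(L.g : E3), ‖L.dir‖⁻¹ • L.dir⟫ = 0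
  rw [inner_smul_right, Lune.dir, inner_sub_right, inner_smul_right, inner_self_coe]
  ring

lemma Lune.semicircle_eq (L : Lune) :
    L.semicircle = {x | x ∈ greatCircle L.g ∧ sdist L.center x ≤ Real.pi / 2} := by
  ext x
  refine and_congr_right fun hx => ?_
  have hx0 : ⟪(L.g : E3), (x : E3)⟫ = 0 := hx
  have hp : 0 < ‖L.dir‖⁻¹ := inv_pos.mpr (norm_pos_iff.mpr L.dir_ne_zero)
  have e : ⟪(L.center : E3), (x : E3)⟫ = ‖L.dir‖⁻¹ * ⟪(L.h : E3), (x : E3)⟫ := by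
    change ⟪‖L.dir‖⁻¹ • L.dir, (x : E3)⟫ = _
    rw [real_inner_smul_left, Lune.dir, inner_sub_left, real_inner_smul_left, hx0]
    ring
  change sdist L.h x ≤ Real.pi / 2 ↔ _
  rw [sdist_le_pi_div_two_iff, sdist_le_pi_div_two_iff, e, mul_nonneg_iff_of_pos_left hp]

/-- The center of the semicircle `G/H` exists, is unique, and is `L.center`. -/
lemma Lune.isSemicircleCenter_iff (L : Lune) (p : S2) :
    IsSemicircleCenter p L.semicircle ↔ p = L.center := by
  constructor
  · rintro ⟨m, hpm, hQ⟩
    rw [L.semicircle_eq] at hQ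
    set c := L.center with hc
    have hcg : ⟪(L.g : E3), (c : E3)⟫ = 0 := L.center_mem
    have hp : p ∈ {x | x ∈ greatCircle L.g ∧ sdist c x ≤ Real.pi / 2} := by
      rw [hQ]
      exact ⟨hpm, by rw [sdist_le_pi_div_two_iff, inner_self_coe]; exact zero_le_one⟩
    have hpg : ⟪(L.g : E3), (p : E3)⟫ = 0 := hp.1
    have hcp : 0 ≤ ⟪(c : E3), (p : E3)⟫ := (sdist_le_pi_div_two_iff _ _).mp hp.2
    set t : ℝ := ⟪(c : E3), (p : E3)⟫ with ht
    -- a vector orthogonal to `g` and `c` is orthogonal to `p`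
    have key : ∀ u : S2, ⟪(L.g : E3), (u : E3)⟫ = 0 → ⟪(c : E3), (u : E3)⟫ = 0 →
        0 ≤ ⟪(p : E3), (u : E3)⟫ := by
      intro u h1 h2
      have hu : u ∈ {x | x ∈ greatCircle L.g ∧ sdist c x ≤ Real.pi / 2} :=
        ⟨h1, by rw [sdist_le_pi_div_two_iff, h2]⟩
      rw [hQ] at hu
      exact (sdist_le_pi_div_two_iff _ _).mp hu.2
    have hv : (p : E3) - t • (c : E3) = 0 := by
      by_contra hne
      set v : E3 := (p : E3) - t • (c : E3) with hvdef
      have hpos : 0 < ‖v‖ := norm_pos_iff.mpr hne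
      have hgv : ⟪(L.g : E3), v⟫ = 0 := by
        rw [hvdef, inner_sub_right, inner_smul_right, hpg, hcg]; ring
      have hcv : ⟪(c : E3), v⟫ = 0 := by
        rw [hvdef, inner_sub_right, inner_smul_right, inner_self_coe]; ring
      have hpv : ⟪(p : E3), v⟫ = ‖v‖ ^ 2 := by
        have h1 : (p : E3) = v + t • (c : E3) := by rw [hvdef]; abel
        calc ⟪(p : E3), v⟫ = ⟪v + t • (c : E3), v⟫ := by rw [← h1]
          _ = ‖v‖ ^ 2 := by
            rw [inner_add_left, real_inner_smul_left, hcv, real_inner_self_eq_norm_sq]; ring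
      let u : S2 := ⟨(-‖v‖⁻¹) • v, by
        rw [mem_sphere_zero_iff_norm, norm_smul, norm_neg, norm_inv, norm_norm,
          inv_mul_cancel₀ hpos.ne']⟩
      have h3 := key u (by change ⟪(L.g : E3), (-‖v‖⁻¹) • v⟫ = 0; rw [inner_smul_right, hgv, mul_zero])
        (by change ⟪(c : E3), (-‖v‖⁻¹) • v⟫ = 0; rw [inner_smul_right, hcv, mul_zero])
      change 0 ≤ ⟪(p : E3), (-‖v‖⁻¹) • v⟫ at h3
      rw [inner_smul_right, hpv] at h3
      have : 0 < ‖v‖⁻¹ * ‖v‖ ^ 2 := by positivity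
      linarith
    have hpc : (p : E3) = t • (c : E3) := sub_eq_zero.mp hv
    have ht1 : t = 1 := by
      have := congrArg norm hpc
      rw [norm_smul, norm_coe, norm_coe, mul_one, Real.norm_eq_abs, abs_of_nonneg hcp] at this
      exact this.symm
    exact Subtype.ext (by rw [hpc, ht1, one_smul])
  · rintro rfl
    exact ⟨L.g, L.center_mem, L.semicircle_eq⟩

/-- The thickness of a lune: the distance of the centers of the two bounding semicircles. -/
def Lune.thickness (L : Lune) : ℝ := sdist L.center L.swap.center

/-- The width of `C` determined by the hemisphere `K` with center `k`: the minimum thickness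
of the lunes `K ∩ K'`, where `K'` is a hemisphere supporting `C`. -/
def width (C : Set S2) (k : S2) : ℝ :=
  sInf {t : ℝ | ∃ L : Lune, L.g = k ∧ Supports L.h C ∧ t = L.thickness}

/-- `C` is of constant width: all hemispheres supporting `C` determine the same width. -/
def IsOfConstantWidth (C : Set S2) : Prop :=
  ∀ k₁ k₂ : S2, Supports k₁ C → Supports k₂ C → width C k₁ = width C k₂

/-- The thickness of `C`: the minimum width of `C` over all supporting hemispheres. -/
def thickness (C : Set S2) : ℝ :=
  sInf {t : ℝ | ∃ k : S2, Supports k C ∧ t = width C k}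

end SphericalConvex

end

/-! Everything is transferred to the dual cone `polar C`. Its unit vectors are the centers of the
hemispheres containing `C`, and those on its boundary (`Touches`) are the centers of the supporting
ones. A lune with hemisphere centers `g`, `h` has thickness π minus the distance from `g` to `h`
(`Lune.thickness_eq`), so a lune of minimal thickness comes from an `h` farthest from `g` in the
dual cone. Constant width thus means that every boundary direction of the dual cone has the same
farthest distance, with cosine `k` (`HasDualDiameter`).

With `s` the sine of that distance, a farthest `h` has the form `k • g + s • q` for a unit vector
`q` orthogonal to `g`, and `q` is the center of the semicircle on the great circle of `g`. Being
farthest is a mutual relation here, so the first variation at `g` puts `q` in the bidual of `C`,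
which is `C` itself (`exists_mem`). Each supporting great circle thus carries at least one center of
a diametral lune; what remains is that every boundary point is such a center.

Three facts give this. The cone over the centers contains `C`, since a vector separating a point of
`C` from the centers would lead to a supporting great circle without a center
(`exists_smul_mem_convexHull`). A center on the great circle of a supporting `g` is a center with
respect to `g` itself (`mem_diametral_of_normal`). The centers with respect to a fixed `g` form a
convex set (`mem_polar_of_between`). If now `p` lies on the great circle of `g`, only centers on
that circle can contribute to a combination representing a multiple of `p`, so `p` is itself a
center with respect to `g`. -/

namespace SphericalConvex

/-! ### Compact convex hulls and separation from a ray -/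

/-- In a finite-dimensional space the convex hull of a compact set is compact. -/
lemma isCompact_convexHull_of_isCompact {E : Type*} [NormedAddCommGroup E] [NormedSpace ℝ E]
    [FiniteDimensional ℝ E] {A : Set E} (hA : IsCompact A) : IsCompact (convexHull ℝ A) := by
  rcases A.eq_empty_or_nonempty with rfl | ⟨a₀, ha₀⟩
  · simp
  set N := Module.finrank ℝ E + 1
  have hK : IsCompact ((Set.univ.pi fun _ : Fin N => A) ×ˢ stdSimplex ℝ (Fin N)) :=
    (isCompact_univ_pi fun _ => hA).prod (isCompact_stdSimplex ℝ (Fin N))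
  have hf : Continuous fun y : (Fin N → E) × (Fin N → ℝ) => ∑ i, y.2 i • y.1 i := by fun_prop
  convert hK.image hf using 1
  apply Set.Subset.antisymm
  · intro x hx
    obtain ⟨ι, _, z, w, hz, hind, hw, hw1, hx⟩ := eq_pos_convex_span_of_mem_convexHull hx
    have hcard : Fintype.card ι ≤ Fintype.card (Fin N) := by
      rw [Fintype.card_fin]
      exact hind.card_le_finrank_succ.trans (Nat.succ_le_succ (Submodule.finrank_le _))
    obtain ⟨e⟩ := Function.Embedding.nonempty_of_card_le hcard
    -- Carathéodory yields at most `N` points; the remaining slots hold `a₀` with weight 0.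
    refine ⟨(Function.extend e z fun _ => a₀, Function.extend e w 0), ⟨fun i _ => ?_, ?_, ?_⟩, ?_⟩
    · by_cases hi : ∃ j, e j = i
      · obtain ⟨j, rfl⟩ := hi
        simpa [e.injective.extend_apply] using hz ⟨j, rfl⟩
      · simpa [Function.extend_apply' _ _ _ hi] using ha₀
    · intro i
      by_cases hi : ∃ j, e j = i
      · obtain ⟨j, rfl⟩ := hi
        simpa [e.injective.extend_apply] using (hw j).le
      · simp [Function.extend_apply' _ _ _ hi]
    · rw [← hw1]
      symm
      apply Fintype.sum_of_injective e e.injective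
      · intro i hi
        simp [Function.extend_apply' w (0 : Fin N → ℝ) i (by simpa using hi)]
      · intro i
        simp [e.injective.extend_apply]
    · rw [← hx]
      symm
      apply Fintype.sum_of_injective e e.injective
      · intro i hi
        simp [Function.extend_apply' w (0 : Fin N → ℝ) i (by simpa using hi)]
      · intro i
        simp [e.injective.extend_apply]
  · rintro _ ⟨⟨z, w⟩, ⟨hz, hw⟩, rfl⟩
    exact (convex_convexHull ℝ A).sum_mem (fun i _ => hw.1 i) hw.2
      fun i _ => subset_convexHull ℝ A (hz i (Set.mem_univ i))

/-- A compact set whose convex hull misses the ray of `x` is separated from `x` by a plane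
through the origin. -/
lemma exists_inner_pos_of_disjoint_ray {A : Set E3} (hA : IsCompact A) {x : E3} (hx : ‖x‖ = 1)
    (hA1 : ∀ a ∈ A, ‖a‖ = 1) (h : ∀ r : ℝ, 0 ≤ r → r • x ∉ convexHull ℝ A) :
    ∃ v : E3, (∀ a ∈ A, 0 < ⟪v, a⟫) ∧ ⟪v, x⟫ < 0 := by
  set R : Set E3 := (fun r : ℝ => r • x) '' Set.Ici 0 with hR
  have hRconv : Convex ℝ R :=
    (convex_Ici (0 : ℝ)).is_linear_image (IsLinearMap.isLinearMap_smul' x)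
  have hRclosed : IsClosed R := by
    have hRe : R = {y | y = ⟪x, y⟫ • x} ∩ {y | 0 ≤ ⟪x, y⟫} := by
      ext y
      constructor
      · rintro ⟨r, hr, rfl⟩
        have : ⟪x, r • x⟫ = r := by
          rw [inner_smul_right, real_inner_self_eq_norm_sq, hx]; ring
        exact ⟨by change r • x = ⟪x, r • x⟫ • x; rw [this], by change 0 ≤ ⟪x, r • x⟫; rw [this]; exact hr⟩
      · rintro ⟨h1, h2⟩
        exact ⟨_, h2, h1.symm⟩
    rw [hRe]
    exact (isClosed_eq (by fun_prop) (by fun_prop)).inter (isClosed_le (by fun_prop) (by fun_prop))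
  have hd : Disjoint (convexHull ℝ A) R := by
    rw [Set.disjoint_right]
    rintro _ ⟨r, hr, rfl⟩
    exact h r hr
  obtain ⟨f, u, v, hfA, huv, hfR⟩ := geometric_hahn_banach_compact_closed (convex_convexHull ℝ A)
    (isCompact_convexHull_of_isCompact hA) hRconv hRclosed hd
  have hv0 : v < 0 := by simpa using hfR 0 ⟨0, le_refl (0 : ℝ), by simp⟩
  have hfx : 0 ≤ f x := by
    by_contra! hneg
    have := hfR ((v / f x) • x) ⟨_, (div_pos_of_neg_of_neg hv0 hneg).le, rfl⟩
    rw [map_smul, smul_eq_mul, div_mul_cancel₀ _ hneg.ne] at this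
    exact lt_irrefl _ this
  set c := (InnerProductSpace.toDual ℝ E3).symm f
  have hc : ∀ y, ⟪c, y⟫ = f y := fun y => InnerProductSpace.toDual_symm_apply
  -- `-c` alone is only known to be nonpositive at `x`. As `u < 0`, adding `u • x` makes this
  -- strict, and on the unit vectors of `A`, where `-f` exceeds `-u`, it lowers the value by at most
  -- `-u`.
  refine ⟨-c + u • x, fun a ha => ?_, ?_⟩
  · have h1 := hfA a (subset_convexHull ℝ A ha)
    have h2 : |⟪x, a⟫| ≤ 1 := by
      simpa [hx, hA1 a ha] using abs_real_inner_le_norm x a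
    rw [inner_add_left, inner_neg_left, real_inner_smul_left, hc]
    nlinarith [(abs_le.mp h2).2]
  · rw [inner_add_left, inner_neg_left, real_inner_smul_left, hc, real_inner_self_eq_norm_sq, hx]
    linarith

/-! ### Cones over subsets of the sphere -/

/-- The open rays from the origin through the points of `T`. -/
def rays (T : Set S2) : Set E3 := {y | ∃ r : ℝ, 0 < r ∧ ∃ x ∈ T, y = r • (x : E3)}

lemma coe_mem_rays {T : Set S2} {x : S2} (hx : x ∈ T) : (x : E3) ∈ rays T :=
  ⟨1, one_pos, x, hx, (one_smul ℝ _).symm⟩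

/-- The case `t = 0` does no harm: `rays T` omits the origin, and comparing norms gives `t = r > 0`.
-/
lemma mem_of_coe_eq_smul {T : Set S2} {p : S2} {t : ℝ} (ht : 0 ≤ t)
    (h : t • (p : E3) ∈ rays T) : p ∈ T := by
  obtain ⟨r, hr, x, hx, e⟩ := h
  have hn := congrArg norm e
  rw [norm_smul, norm_smul, norm_coe, norm_coe, Real.norm_of_nonneg ht,
    Real.norm_of_nonneg hr.le, mul_one, mul_one] at hn
  subst hn
  have : (p : E3) = x := smul_right_injective E3 hr.ne' e
  rwa [Subtype.ext this]

lemma convex_rays {T : Set S2}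
    (h : ∀ a ∈ T, ∀ b ∈ T, ∀ s t : ℝ, 0 < s → 0 < t → s • (a : E3) + t • (b : E3) ∈ rays T) :
    Convex ℝ (rays T) := by
  rw [convex_iff_forall_pos]
  rintro _ ⟨r, hr, x, hx, rfl⟩ _ ⟨r', hr', x', hx', rfl⟩ a b ha hb -
  rw [smul_smul, smul_smul]
  exact h x hx x' hx' _ _ (mul_pos ha hr) (mul_pos hb hr')

/-- The unit vector in the direction of a nonzero vector. -/
noncomputable def normalize (y : E3) (hy : y ≠ 0) : S2 :=
  ⟨‖y‖⁻¹ • y, by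
    rw [mem_sphere_zero_iff_norm, norm_smul, norm_inv, norm_norm,
      inv_mul_cancel₀ (norm_ne_zero_iff.mpr hy)]⟩

lemma norm_smul_normalize (y : E3) (hy : y ≠ 0) : ‖y‖ • (normalize y hy : E3) = y := by
  change ‖y‖ • ‖y‖⁻¹ • y = y
  rw [smul_smul, mul_inv_cancel₀ (norm_ne_zero_iff.mpr hy), one_smul]

/-- A vanishing combination would make `a` and `b` antipodes. Hence the cone can be convex although
it omits the origin. -/
lemma IsConvex.add_ne_zero {C : Set S2} (hC : IsConvex C) {a b : S2} (ha : a ∈ C) (hb : b ∈ C)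
    {s t : ℝ} (hs : 0 < s) (ht : 0 < t) : s • (a : E3) + t • (b : E3) ≠ 0 := by
  intro h0
  have e : s • (a : E3) = t • ((-b : S2) : E3) := by
    rw [show ((-b : S2) : E3) = -(b : E3) from rfl, smul_neg]; exact eq_neg_of_add_eq_zero_left h0
  have : a ∈ ({-b} : Set S2) :=
    mem_of_coe_eq_smul hs.le ⟨t, ht, -b, rfl, e⟩
  rw [Set.mem_singleton_iff] at this
  exact hC.1 b hb (this ▸ ha)

lemma IsConvex.convex_rays {C : Set S2} (hC : IsConvex C) : Convex ℝ (rays C) := by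
  refine SphericalConvex.convex_rays fun a ha b hb s t hs ht => ?_
  have h0 := hC.add_ne_zero ha hb hs ht
  have hn : 0 < ‖s • (a : E3) + t • (b : E3)‖ := norm_pos_iff.mpr h0
  refine ⟨_, hn, normalize _ h0, hC.2 a ha b hb
    ⟨‖s • (a : E3) + t • (b : E3)‖⁻¹ * s, ‖s • (a : E3) + t • (b : E3)‖⁻¹ * t,
      by positivity, by positivity, ?_⟩, (norm_smul_normalize _ h0).symm⟩
  change _ • (_ + _) = _
  rw [smul_add, smul_smul, smul_smul]

lemma isCompact_coe_image {T : Set S2} (hT : IsClosed T) :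
    IsCompact ((fun x : S2 => (x : E3)) '' T) :=
  hT.isCompact.image continuous_subtype_val

/-- The convex hull of `C` stays inside the cone `rays C`, so it can meet the ray of `x` only if `x
∈ C`. -/
lemma exists_inner_pos_of_notMem {C : Set S2} (hcl : IsClosed C) (hC : IsConvex C) {x : S2}
    (hx : x ∉ C) : ∃ v : E3, (∀ a ∈ C, 0 < ⟪v, (a : E3)⟫) ∧ ⟪v, (x : E3)⟫ < 0 := by
  obtain ⟨v, hv, hvx⟩ := exists_inner_pos_of_disjoint_ray (isCompact_coe_image hcl) (norm_coe x)
    (by rintro _ ⟨a, -, rfl⟩; exact norm_coe a) (by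
      intro r hr hmem
      refine hx (mem_of_coe_eq_smul hr (convexHull_min ?_ hC.convex_rays hmem))
      rintro _ ⟨a, ha, rfl⟩
      exact coe_mem_rays ha)
  exact ⟨v, fun a ha => hv a ⟨a, ha, rfl⟩, hvx⟩

/-! ### The dual cone, its boundary and its farthest vectors -/

/-- The dual cone of a subset of the sphere. -/
def polar (C : Set S2) : Set E3 := {v | ∀ x ∈ C, 0 ≤ ⟪v, (x : E3)⟫}

lemma polar_add {C : Set S2} {u v : E3} (hu : u ∈ polar C) (hv : v ∈ polar C) :
    u + v ∈ polar C := fun x hx => by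
  rw [inner_add_left]; exact add_nonneg (hu x hx) (hv x hx)

lemma polar_smul {C : Set S2} {v : E3} {t : ℝ} (ht : 0 ≤ t) (hv : v ∈ polar C) :
    t • v ∈ polar C := fun x hx => by
  rw [real_inner_smul_left]; exact mul_nonneg ht (hv x hx)

lemma isClosed_polar (C : Set S2) : IsClosed (polar C) := by
  have : polar C = ⋂ x ∈ C, {v | 0 ≤ ⟪v, (x : E3)⟫} := by ext; simp [polar]
  rw [this]
  exact isClosed_biInter fun x _ => isClosed_le (by fun_prop) (by fun_prop)

/-- A closed convex set is the dual of its dual cone. -/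
lemma mem_of_forall_polar {C : Set S2} (hcl : IsClosed C) (hC : IsConvex C) {x : S2}
    (h : ∀ v ∈ polar C, 0 ≤ ⟪v, (x : E3)⟫) : x ∈ C := by
  by_contra hx
  obtain ⟨v, hv, hvx⟩ := exists_inner_pos_of_notMem hcl hC hx
  exact hvx.not_ge (h v fun a ha => (hv a ha).le)

lemma mem_rays_of_forall_polar {C : Set S2} (hcl : IsClosed C) (hC : IsConvex C) {y : E3}
    (hy : y ≠ 0) (h : ∀ v ∈ polar C, 0 ≤ ⟪v, y⟫) : y ∈ rays C := by
  refine ⟨‖y‖, norm_pos_iff.mpr hy, normalize y hy, mem_of_forall_polar hcl hC fun v hv => ?_,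
    (norm_smul_normalize y hy).symm⟩
  change 0 ≤ ⟪v, ‖y‖⁻¹ • y⟫
  rw [inner_smul_right]
  exact mul_nonneg (inv_nonneg.mpr (norm_nonneg _)) (h v hv)

/-- The unit vectors of the dual cone form a compact set. -/
lemma isCompact_unit_polar (C : Set S2) : IsCompact (polar C ∩ {v | ‖v‖ = 1}) := by
  have : {v : E3 | ‖v‖ = 1} = Metric.sphere 0 1 := by ext; simp
  rw [this, Set.inter_comm]
  exact (isCompact_sphere 0 1).inter_right (isClosed_polar C)

/-- `v` spans a supporting hemisphere: it is nonnegative on `C` and vanishes somewhere on `C`. -/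
def Touches (C : Set S2) (v : E3) : Prop := v ∈ polar C ∧ ∃ x ∈ C, ⟪v, (x : E3)⟫ = 0

lemma Touches.smul {C : Set S2} {v : E3} (h : Touches C v) {t : ℝ} (ht : 0 ≤ t) :
    Touches C (t • v) := by
  obtain ⟨h1, x, hx, h2⟩ := h
  exact ⟨polar_smul ht h1, x, hx, by rw [real_inner_smul_left, h2, mul_zero]⟩

/-- On the way from a vector of the dual cone to a vector outside there is a vector on the
boundary. -/
lemma exists_touches_between {C : Set S2} (hcl : IsClosed C) {a b : E3} (ha : a ∈ polar C)
    (hb : b ∉ polar C) : ∃ s : ℝ, 0 ≤ s ∧ s < 1 ∧ Touches C ((1 - s) • a + s • b) := by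
  obtain ⟨z, hz, hbz⟩ : ∃ z ∈ C, ⟪b, (z : E3)⟫ < 0 := by simpa [polar] using hb
  have hne : C.Nonempty := ⟨z, hz⟩
  set F : ℝ → S2 → ℝ := fun s x => ⟪(1 - s) • a + s • b, (x : E3)⟫ with hF
  have hFc : Continuous (Function.uncurry F) := by
    simp only [hF, Function.uncurry_def]; fun_prop
  have hFs : ∀ s, Continuous (F s) := fun s => by simp only [hF]; fun_prop
  set m : ℝ → ℝ := fun s => sInf (F s '' C)
  have hm : Continuous m := hcl.isCompact.continuous_sInf hFc
  have hle : ∀ s, ∀ x ∈ C, m s ≤ F s x := fun s x hx =>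
    csInf_le (hcl.isCompact.image (hFs s)).bddBelow ⟨x, hx, rfl⟩
  have hatt : ∀ s, ∃ x ∈ C, F s x = m s := fun s =>
    (hcl.isCompact.image (hFs s)).sInf_mem (hne.image _)
  have h0 : 0 ≤ m 0 := by
    obtain ⟨x, hx, e⟩ := hatt 0
    rw [← e]; simpa [hF] using ha x hx
  have h1 : m 1 < 0 := (hle 1 z hz).trans_lt (by simpa [hF] using hbz)
  obtain ⟨s, ⟨hs0, hs1⟩, hs⟩ := intermediate_value_Icc' zero_le_one hm.continuousOn ⟨h1.le, h0⟩
  refine ⟨s, hs0, lt_of_le_of_ne hs1 fun e => ?_, fun x hx => hs ▸ hle s x hx, ?_⟩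
  · rw [e] at hs; exact h1.ne hs
  · obtain ⟨x, hx, e⟩ := hatt s
    exact ⟨x, hx, e.trans hs⟩

/-- If `h` is, in the dual cone, a unit vector farthest from `g`, then the dual cone lies on one
side of the plane through `h` orthogonal to the arc from `g` to `h`. -/
lemma inner_sub_smul_nonneg_of_farthest {C : Set S2} {g h x : E3} (hh1 : ‖h‖ = 1)
    (hh : h ∈ polar C) (hmin : ∀ v ∈ polar C, ⟪g, h⟫ * ‖v‖ ≤ ⟪g, v⟫) (hx : x ∈ polar C) :
    0 ≤ ⟪x, g - ⟪g, h⟫ • h⟫ := by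
  set κ := ⟪g, h⟫ with hκ
  rw [inner_sub_right, inner_smul_right, real_inner_comm g x]
  have hhh : ⟪h, h⟫ = 1 := by rw [real_inner_self_eq_norm_sq, hh1, one_pow]
  have hline : ∀ t : ℝ, 0 ≤ t → κ * ‖h + t • x‖ ≤ κ + t * ⟪g, x⟫ := fun t ht => by
    simpa [inner_add_right, inner_smul_right, ← hκ] using hmin _ (polar_add hh (polar_smul ht hx))
  have hlow : ∀ t : ℝ, 1 + t * ⟪x, h⟫ ≤ ‖h + t • x‖ := fun t => by
    have := real_inner_le_norm h (h + t • x)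
    rwa [hh1, one_mul, inner_add_right, inner_smul_right, hhh, real_inner_comm x h] at this
  have hup : ∀ t : ℝ, ‖h + t • x‖ ≤ 1 + t * ⟪x, h⟫ + t ^ 2 * ‖x‖ ^ 2 / 2 := fun t => by
    have h2 : ‖h + t • x‖ ^ 2 = 1 + 2 * (t * ⟪x, h⟫) + t ^ 2 * ‖x‖ ^ 2 := by
      rw [norm_add_sq_real, hh1, inner_smul_right, norm_smul, mul_pow, Real.norm_eq_abs, sq_abs,
        real_inner_comm x h]
      ring
    nlinarith [sq_nonneg (‖h + t • x‖ - 1)]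
  -- For `κ ≥ 0` the linear lower bound on the norm suffices. For `κ < 0` an upper bound is needed,
  -- and its quadratic error is removed by taking `t` small.
  rcases le_or_gt 0 κ with h0 | h0
  · nlinarith [hline 1 zero_le_one, hlow 1]
  · have key : ∀ t : ℝ, 0 < t → -(⟪g, x⟫ - κ * ⟪x, h⟫) ≤ t * (-κ * ‖x‖ ^ 2 / 2) := fun t ht => by
      have h1 := hline t ht.le
      have h2 := mul_le_mul_of_nonpos_left (hup t) h0.le
      have h3 : 0 ≤ t * (t * (-κ * ‖x‖ ^ 2 / 2) + (⟪g, x⟫ - κ * ⟪x, h⟫)) := by nlinarith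
      linarith [nonneg_of_mul_nonneg_right h3 ht]
    by_contra! hneg
    have hK : 0 ≤ -κ * ‖x‖ ^ 2 / 2 := by nlinarith [sq_nonneg ‖x‖]
    set K := -κ * ‖x‖ ^ 2 / 2
    set d := -(⟪g, x⟫ - κ * ⟪x, h⟫) with hd
    have hdpos : 0 < d := by linarith
    -- Any `t > 0` with `t * K < d` would do; `K + 1` avoids dividing by zero.
    have h4 := key (d / (2 * (K + 1))) (by positivity)
    have h5 : d / (2 * (K + 1)) * K ≤ d / 2 := by
      rw [div_mul_eq_mul_div, div_le_div_iff₀ (by positivity) two_pos]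
      nlinarith
    linarith

/-- A compact dual cone contains a unit vector farthest from a given vector. -/
lemma exists_farthest {C : Set S2} (g : E3) {c : E3} (hc : c ∈ polar C) (hc1 : ‖c‖ = 1) :
    ∃ h ∈ polar C, ‖h‖ = 1 ∧ ∀ v ∈ polar C, ⟪g, h⟫ * ‖v‖ ≤ ⟪g, v⟫ := by
  obtain ⟨h, ⟨hh, hh1⟩, hmin⟩ := (isCompact_unit_polar C).exists_isMinOn ⟨c, hc, hc1⟩
    (f := fun v => ⟪g, v⟫) (by fun_prop)
  refine ⟨h, hh, hh1, fun v hv => ?_⟩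
  rcases eq_or_ne v 0 with rfl | hv0
  · simp
  have hn : 0 < ‖v‖ := norm_pos_iff.mpr hv0
  have h1 : ⟪g, h⟫ ≤ ⟪g, ‖v‖⁻¹ • v⟫ := hmin ⟨polar_smul (inv_nonneg.mpr hn.le) hv, by
    rw [Set.mem_ofPred_eq, norm_smul, norm_inv, norm_norm, inv_mul_cancel₀ hn.ne']⟩
  rw [inner_smul_right] at h1
  calc ⟪g, h⟫ * ‖v‖ ≤ ‖v‖⁻¹ * ⟪g, v⟫ * ‖v‖ := by gcongr
    _ = ⟪g, v⟫ := by field_simp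

/-- If the product were zero, a small move of `x` in the direction `-g` would stay in `C` and make
it negative. -/
lemma inner_pos_of_mem_interior {C : Set S2} {g : E3} (hg0 : g ≠ 0) (hg : g ∈ polar C) {x : S2}
    (hx : x ∈ interior C) : 0 < ⟪g, (x : E3)⟫ := by
  by_contra! hle
  have hgx : ⟪g, (x : E3)⟫ = 0 := le_antisymm hle (hg x (interior_subset hx))
  have hgg : 0 < ⟪g, g⟫ := real_inner_self_pos.mpr hg0
  have hne : ∀ t : ℝ, (x : E3) - t • g ≠ 0 := fun t h0 => by
    have h1 := congrArg (fun y => ⟪(x : E3), y⟫) h0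
    simp only [inner_sub_right, inner_smul_right, inner_zero_right, inner_self_coe,
      real_inner_comm g (x : E3), hgx] at h1
    linarith
  let γ : ℝ → S2 := fun t => normalize ((x : E3) - t • g) (hne t)
  have hγ : Continuous γ := by
    apply Continuous.subtype_mk
    have hinv : Continuous fun t : ℝ => ‖(x : E3) - t • g‖⁻¹ :=
      Continuous.inv₀ (by fun_prop) fun t => norm_ne_zero_iff.mpr (hne t)
    fun_prop
  have hγ0 : γ 0 = x := Subtype.ext (by simp [γ, normalize])
  have hev : ∀ᶠ t in nhdsWithin (0 : ℝ) (Set.Ioi 0), γ t ∈ C := by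
    apply nhdsWithin_le_nhds
    apply hγ.continuousAt.eventually
    rw [hγ0]
    exact mem_interior_iff_mem_nhds.mp hx
  obtain ⟨t, htC, ht⟩ := (hev.and self_mem_nhdsWithin).exists
  have ht0 : (0 : ℝ) < t := ht
  have h1 := hg _ htC
  change 0 ≤ ⟪g, ‖(x : E3) - t • g‖⁻¹ • ((x : E3) - t • g)⟫ at h1
  rw [inner_smul_right, inner_sub_right, inner_smul_right, hgx] at h1
  have h2 : 0 < ‖(x : E3) - t • g‖⁻¹ := inv_pos.mpr (norm_pos_iff.mpr (hne t))
  nlinarith [mul_pos ht0 hgg, mul_pos h2 (mul_pos ht0 hgg)]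

lemma mem_frontier_of_inner_eq_zero {C : Set S2} {g : E3} (hg0 : g ≠ 0) (hg : g ∈ polar C) {x : S2}
    (hx : x ∈ C) (hgx : ⟪g, (x : E3)⟫ = 0) : x ∈ frontier C :=
  ⟨subset_closure hx, fun hi => (inner_pos_of_mem_interior hg0 hg hi).ne' hgx⟩

lemma neg_notMem_polar {C : Set S2} (hC : (interior C).Nonempty) {g : E3} (hg0 : g ≠ 0)
    (hg : g ∈ polar C) : -g ∉ polar C := fun hn => by
  obtain ⟨x, hx⟩ := hC
  have h1 := inner_pos_of_mem_interior hg0 hg hx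
  have h2 := inner_pos_of_mem_interior (neg_ne_zero.mpr hg0) hn hx
  rw [inner_neg_left] at h2
  linarith

/-- A convex body is contained in an open hemisphere. -/
lemma IsConvexBody.exists_inner_pos {C : Set S2} (hC : IsConvexBody C) :
    ∃ c : E3, ‖c‖ = 1 ∧ ∀ x ∈ C, 0 < ⟪c, (x : E3)⟫ := by
  obtain ⟨hcl, hconv, y, hy⟩ := hC
  have hy := interior_subset hy
  obtain ⟨v, hv, -⟩ := exists_inner_pos_of_notMem hcl hconv (hconv.1 y hy)
  have hv0 : v ≠ 0 := by
    rintro rfl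
    simpa using hv y hy
  have hn : 0 < ‖v‖ := norm_pos_iff.mpr hv0
  refine ⟨‖v‖⁻¹ • v, ?_, fun x hx => ?_⟩
  · rw [norm_smul, norm_inv, norm_norm, inv_mul_cancel₀ hn.ne']
  · rw [real_inner_smul_left]
    exact mul_pos (inv_pos.mpr hn) (hv x hx)

/-- Every boundary point of a convex body lies on a supporting great circle. -/
lemma IsConvexBody.exists_normal {C : Set S2} (hC : IsConvexBody C) {p : S2}
    (hp : p ∈ frontier C) : ∃ g ∈ polar C, ‖g‖ = 1 ∧ ⟪g, (p : E3)⟫ = 0 := by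
  obtain ⟨hcl, hconv, -⟩ := id hC
  obtain ⟨c, hc1, hc⟩ := hC.exists_inner_pos
  obtain ⟨g, hg, hg1, hmin⟩ := exists_farthest (C := C) (p : E3) (fun x hx => (hc x hx).le) hc1
  refine ⟨g, hg, hg1, ?_⟩
  have hpC : p ∈ C := hcl.frontier_subset hp
  by_contra hne
  have hpos : 0 < ⟪g, (p : E3)⟫ := lt_of_le_of_ne (hg p hpC) (Ne.symm hne)
  -- If the least product of `p` with unit vectors of the dual cone is positive, it is the radius of
  -- a ball around `p` contained in the bidual.
  refine hp.2 (mem_interior_iff_mem_nhds.mpr ?_)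
  filter_upwards [Metric.ball_mem_nhds p hpos] with x hx
  apply mem_of_forall_polar hcl hconv
  intro v hv
  have h1 := hmin v hv
  rw [real_inner_comm, real_inner_comm v] at h1
  have hd : ‖(p : E3) - x‖ ≤ ⟪g, (p : E3)⟫ := by
    have : dist x p < _ := hx
    rw [dist_comm, Subtype.dist_eq, dist_eq_norm] at this
    exact this.le
  have h2 := real_inner_le_norm v ((p : E3) - x)
  rw [inner_sub_right] at h2
  nlinarith [norm_nonneg v]

/-! ### Constant diameter of the dual cone -/

/-- Every boundary direction of the dual cone has the same greatest angular distance, with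
cosine `k`, to the dual cone. -/
structure HasDualDiameter (C : Set S2) (k : ℝ) : Prop where
  le : ∀ g, ‖g‖ = 1 → Touches C g → ∀ v ∈ polar C, k * ‖v‖ ≤ ⟪g, v⟫
  exists_eq : ∀ g, ‖g‖ = 1 → Touches C g → ∃ h ∈ polar C, ‖h‖ = 1 ∧ ⟪g, h⟫ = k

lemma norm_sub_smul_sq {g h : E3} (hg : ‖g‖ = 1) (hh : ‖h‖ = 1) :
    ‖h - ⟪g, h⟫ • g‖ ^ 2 = 1 - ⟪g, h⟫ ^ 2 := by
  rw [norm_sub_sq_real, hh, inner_smul_right, norm_smul, hg, Real.norm_eq_abs, mul_one, sq_abs,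
    real_inner_comm g h]
  ring

/-- The farthest unit vector of the dual cone is on its boundary. -/
lemma touches_of_farthest {C : Set S2} (hcl : IsClosed C) (hC : IsConvex C) {g h : E3}
    (hg : ‖g‖ = 1) (hh1 : ‖h‖ = 1) (hh : h ∈ polar C)
    (hmin : ∀ v ∈ polar C, ⟪g, h⟫ * ‖v‖ ≤ ⟪g, v⟫) (h1 : ⟪g, h⟫ ^ 2 < 1) : Touches C h := by
  have hn := norm_sub_smul_sq hh1 hg
  rw [real_inner_comm g h] at hn
  have h0 : g - ⟪g, h⟫ • h ≠ 0 := fun e => by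
    rw [e, norm_zero] at hn; linarith
  obtain ⟨r, hr, x, hx, e⟩ := mem_rays_of_forall_polar hcl hC h0 fun v hv =>
    inner_sub_smul_nonneg_of_farthest hh1 hh hmin hv
  refine ⟨hh, x, hx, ?_⟩
  have h3 : ⟪h, r • (x : E3)⟫ = 0 := by
    rw [← e, inner_sub_right, inner_smul_right, real_inner_self_eq_norm_sq, hh1,
      real_inner_comm g h]
    ring
  rw [inner_smul_right] at h3
  exact (mul_eq_zero.mp h3).resolve_left hr.ne'

/-- In a boundary direction `g` some diametral direction `k • g + s • q` has `q` in `C`. -/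
lemma HasDualDiameter.exists_mem {C : Set S2} (hcl : IsClosed C) (hC : IsConvex C) {k s : ℝ}
    (hk : HasDualDiameter C k) (hs : 0 < s) (hks : k ^ 2 + s ^ 2 = 1) {g : E3} (hg1 : ‖g‖ = 1)
    (hg : Touches C g) : ∃ q ∈ C, ⟪g, (q : E3)⟫ = 0 ∧ k • g + s • (q : E3) ∈ polar C := by
  obtain ⟨h, hh, hh1, e⟩ := hk.exists_eq g hg1 hg
  -- As `h` is a boundary direction too, the bound `k` applies to it and `g` is in turn farthest
  -- from `h`. The first variation at `g` then puts `h - k • g` in the bidual.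
  have hth : Touches C h := touches_of_farthest hcl hC hg1 hh1 hh (e ▸ hk.le g hg1 hg)
    (by rw [e]; nlinarith)
  have hmin : ∀ v ∈ polar C, ⟪h, g⟫ * ‖v‖ ≤ ⟪h, v⟫ := by
    rw [real_inner_comm, e]; exact hk.le h hh1 hth
  have hn : ‖h - k • g‖ = s := by
    have := norm_sub_smul_sq hg1 hh1
    rw [e] at this
    exact (sq_eq_sq₀ (norm_nonneg _) hs.le).mp (by linarith)
  have h0 : h - k • g ≠ 0 := fun e0 => by
    rw [e0, norm_zero] at hn; exact hs.ne hn
  obtain ⟨r, hr, q, hq, eq⟩ := mem_rays_of_forall_polar hcl hC h0 fun v hv => by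
    have := inner_sub_smul_nonneg_of_farthest hg1 hg.1 hmin hv
    rwa [real_inner_comm g h, e] at this
  have hrs : r = s := by
    rw [← hn, eq, norm_smul, norm_coe, Real.norm_of_nonneg hr.le, mul_one]
  rw [hrs] at eq
  refine ⟨q, hq, ?_, ?_⟩
  · have h3 : ⟪g, s • (q : E3)⟫ = 0 := by
      rw [← eq, inner_sub_right, inner_smul_right, real_inner_self_eq_norm_sq, hg1, e]; ring
    rw [inner_smul_right] at h3
    exact (mul_eq_zero.mp h3).resolve_left hs.ne'
  · rw [← eq, add_sub_cancel]; exact hh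

/-- Vectors of three-dimensional space orthogonal to two independent vectors are proportional. -/
lemma eq_smul_of_orthogonal {u v x y : E3} (hu : u ≠ 0) (huv : ∀ a : ℝ, a • u ≠ v) (hx : x ≠ 0)
    (hux : ⟪u, x⟫ = 0) (hvx : ⟪v, x⟫ = 0) (huy : ⟪u, y⟫ = 0) (hvy : ⟪v, y⟫ = 0) :
    ∃ c : ℝ, y = c • x := by
  have hli : LinearIndependent ℝ ![u, v] := (LinearIndependent.pair_iff' hu).mpr huv
  set K := Submodule.span ℝ (Set.range ![u, v])
  have hK : Module.finrank ℝ K = 2 := by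
    simpa using finrank_span_eq_card hli
  have hKo : Module.finrank ℝ Kᗮ = 1 := by
    have h1 := K.finrank_add_finrank_orthogonal
    rw [hK, finrank_euclideanSpace_fin] at h1
    omega
  have hmem : ∀ z : E3, ⟪u, z⟫ = 0 → ⟪v, z⟫ = 0 → z ∈ Kᗮ := fun z h1 h2 => by
    rw [Submodule.mem_orthogonal]
    intro w hw
    induction hw using Submodule.span_induction with
    | mem w hw =>
      obtain ⟨i, rfl⟩ := hw
      fin_cases i
      · exact h1
      · exact h2
    | zero => exact inner_zero_left _
    | add a b _ _ ha hb => rw [inner_add_left, ha, hb, add_zero]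
    | smul a b _ hb => rw [inner_smul_left, hb, mul_zero]
  have hx0 : (⟨x, hmem x hux hvx⟩ : Kᗮ) ≠ 0 := fun e => hx (congrArg Subtype.val e)
  obtain ⟨c, hc⟩ := (finrank_eq_one_iff_of_nonzero' _ hx0).mp hKo ⟨y, hmem y huy hvy⟩
  exact ⟨c, (congrArg Subtype.val hc).symm⟩

/-! ### Centers of diametral lunes -/

/-- `q` is the center of a diametral lune of `C` one of whose hemispheres has center `g`. -/
def diametral (C : Set S2) (k s : ℝ) (g : E3) : Set S2 :=
  {q | q ∈ C ∧ ⟪g, (q : E3)⟫ = 0 ∧ k • g + s • (q : E3) ∈ polar C}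

/-- If `q` is the center of a diametral lune, then it is so with respect to every supporting
hemisphere at `q`. -/
lemma HasDualDiameter.mem_diametral_of_normal {C : Set S2} (hC : IsConvexBody C) {k s : ℝ}
    (hk : HasDualDiameter C k) (hs : 0 < s) (hks : k ^ 2 + s ^ 2 = 1) {g g₁ : E3}
    (hg1 : ‖g‖ = 1) (hg : g ∈ polar C) (hg₁1 : ‖g₁‖ = 1) (hg₁ : g₁ ∈ polar C) {q : S2}
    (hq : q ∈ diametral C k s g₁) (hgq : ⟪g, (q : E3)⟫ = 0) : q ∈ diametral C k s g := by
  obtain ⟨hqC, hg₁q, hkq⟩ := hq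
  have hg0 : g ≠ 0 := norm_ne_zero_iff.mp (by rw [hg1]; exact one_ne_zero)
  by_cases hdep : ∃ a : ℝ, a • g = g₁
  · obtain ⟨a, rfl⟩ := hdep
    rw [norm_smul, hg1, mul_one, Real.norm_eq_abs] at hg₁1
    rcases (abs_eq zero_le_one).mp hg₁1 with rfl | rfl
    · rw [one_smul] at hkq
      exact ⟨hqC, hgq, hkq⟩
    · rw [neg_one_smul] at hg₁
      exact absurd hg₁ (neg_notMem_polar hC.2.2 hg0 hg)
  · push Not at hdep
    refine ⟨hqC, hgq, ?_⟩
    -- Strictly between `g` and `g₁`, the plane orthogonal to `w t` meets `C` only at `q`, so the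
    -- center that `exists_mem` provides must be `q`. The claim for `g` is the limit `t → 0`.
    set w : ℝ → E3 := fun t => (1 - t) • g + t • g₁ with hw
    have hin : ∀ t ∈ Set.Ioo (0 : ℝ) 1, k • w t + (s * ‖w t‖) • (q : E3) ∈ polar C := by
      rintro t ⟨ht0, ht1⟩
      have ht1' : 0 < 1 - t := sub_pos.mpr ht1
      have hw0 : w t ≠ 0 := fun h0 => by
        refine hdep (-(t⁻¹ * (1 - t))) ?_
        have h2 : t • g₁ = -((1 - t) • g) := eq_neg_of_add_eq_zero_right h0
        rw [neg_smul, mul_smul, ← smul_neg, ← h2, smul_smul, inv_mul_cancel₀ ht0.ne', one_smul]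
      have hn : 0 < ‖w t‖ := norm_pos_iff.mpr hw0
      have hwp : w t ∈ polar C := polar_add (polar_smul ht1'.le hg) (polar_smul ht0.le hg₁)
      have hwin : ∀ x : S2, ⟪w t, (x : E3)⟫ = (1 - t) * ⟪g, (x : E3)⟫ + t * ⟪g₁, (x : E3)⟫ :=
        fun x => by rw [hw, inner_add_left, real_inner_smul_left, real_inner_smul_left]
      have hwt : Touches C (‖w t‖⁻¹ • w t) :=
        Touches.smul ⟨hwp, q, hqC, by rw [hwin, hgq, hg₁q]; ring⟩ (inv_nonneg.mpr hn.le)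
      obtain ⟨q', hq'C, hq'1, hq'2⟩ := hk.exists_mem hC.1 hC.2.1 hs hks
        (by rw [norm_smul, norm_inv, norm_norm, inv_mul_cancel₀ hn.ne']) hwt
      rw [real_inner_smul_left, hwin] at hq'1
      have h3 := (mul_eq_zero.mp hq'1).resolve_left (inv_pos.mpr hn).ne'
      have h4 := mul_nonneg ht1'.le (hg q' hq'C)
      have h5 := mul_nonneg ht0.le (hg₁ q' hq'C)
      have h6 : ⟪g, (q' : E3)⟫ = 0 :=
        (mul_eq_zero.mp (by linarith : (1 - t) * ⟪g, (q' : E3)⟫ = 0)).resolve_left ht1'.ne'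
      have h7 : ⟪g₁, (q' : E3)⟫ = 0 :=
        (mul_eq_zero.mp (by linarith : t * ⟪g₁, (q' : E3)⟫ = 0)).resolve_left ht0.ne'
      have hq0 : (q : E3) ≠ 0 := norm_ne_zero_iff.mp (by rw [norm_coe]; exact one_ne_zero)
      obtain ⟨c, hc⟩ := eq_smul_of_orthogonal hg0 hdep hq0 hgq hg₁q h6 h7
      have hcn := congrArg norm hc
      rw [norm_smul, norm_coe, norm_coe, mul_one, Real.norm_eq_abs] at hcn
      have hc1 : (q' : E3) = q := by
        rcases (abs_eq zero_le_one).mp hcn.symm with rfl | rfl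
        · rw [hc, one_smul]
        · exact absurd hq'C (by
            rw [show q' = -q from Subtype.ext (by rw [hc, neg_one_smul]; rfl)]
            exact hC.2.1.1 q hqC)
      rw [hc1] at hq'2
      have h8 := polar_smul hn.le hq'2
      rwa [smul_add, smul_comm k, smul_smul, mul_inv_cancel₀ hn.ne', one_smul, smul_smul,
        mul_comm ‖w t‖ s] at h8
    have hcont : Continuous fun t => k • w t + (s * ‖w t‖) • (q : E3) := by
      simp only [hw]; fun_prop
    have h0 : (0 : ℝ) ∈ closure (Set.Ioo (0 : ℝ) 1) := by
      rw [closure_Ioo zero_ne_one]; exact ⟨le_refl _, zero_le_one⟩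
    have := (isClosed_polar C).closure_subset (map_mem_closure hcont h0 hin)
    simpa [hw, hg1] using this

lemma one_le_add_of_norm_eq_one {p a b : E3} (hp : ‖p‖ = 1) (ha : ‖a‖ = 1) (hb : ‖b‖ = 1)
    {α β : ℝ} (hα : 0 ≤ α) (hβ : 0 ≤ β) (e : p = α • a + β • b) : 1 ≤ α + β := by
  have := norm_add_le (α • a) (β • b)
  rwa [← e, norm_smul, norm_smul, ha, hb, hp, mul_one, mul_one, Real.norm_of_nonneg hα,
    Real.norm_of_nonneg hβ] at this

lemma norm_smul_add_smul_sq {g p : E3} (hg : ‖g‖ = 1) (hp : ‖p‖ = 1) (hgp : ⟪g, p⟫ = 0)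
    (a b : ℝ) : ‖a • g + b • p‖ ^ 2 = a ^ 2 + b ^ 2 := by
  rw [norm_add_sq_real, norm_smul, norm_smul, hg, hp, real_inner_smul_left, inner_smul_right, hgp,
    Real.norm_eq_abs, Real.norm_eq_abs, mul_one, mul_one, sq_abs, sq_abs]
  ring

/-- A direction between two diametral directions from `g` is diametral. -/
lemma HasDualDiameter.mem_polar_of_between {C : Set S2} (hC : IsConvexBody C) {k s : ℝ}
    (hk : HasDualDiameter C k) (hs : 0 < s) (hks : k ^ 2 + s ^ 2 = 1) {g : E3}
    (hg1 : ‖g‖ = 1) (hg : g ∈ polar C) {q₁ q₂ p : S2} (hq₁ : q₁ ∈ diametral C k s g)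
    (hq₂ : q₂ ∈ diametral C k s g) {α β : ℝ} (hα : 0 ≤ α) (hβ : 0 ≤ β)
    (e : (p : E3) = α • (q₁ : E3) + β • (q₂ : E3)) : k • g + s • (p : E3) ∈ polar C := by
  obtain ⟨hq₁C, hgq₁, hkq₁⟩ := hq₁
  obtain ⟨hq₂C, hgq₂, hkq₂⟩ := hq₂
  have hσ := one_le_add_of_norm_eq_one (norm_coe p) (norm_coe q₁) (norm_coe q₂) hα hβ e
  have hgp : ⟪g, (p : E3)⟫ = 0 := by
    rw [e, inner_add_right, inner_smul_right, inner_smul_right, hgq₁, hgq₂]; ring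
  have hgg : ⟪g, g⟫ = 1 := by rw [real_inner_self_eq_norm_sq, hg1, one_pow]
  set σ := α + β with hσdef
  set m := (σ * k) • g + s • (p : E3) with hm
  have hmp : m ∈ polar C := by
    have : m = α • (k • g + s • (q₁ : E3)) + β • (k • g + s • (q₂ : E3)) := by
      rw [hm, e, hσdef]; module
    rw [this]
    exact polar_add (polar_smul hα hkq₁) (polar_smul hβ hkq₂)
  -- `m` is the combination of the two diametral directions with weights `α`, `β`. If `k < 0`, the
  -- distance bound from `g` to `m` forces `σ = 1`; if `k = 0`, `m` is already the required vector.
  rcases le_or_gt k 0 with hk0 | hk0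
  · have hN := norm_smul_add_smul_sq hg1 (norm_coe p) hgp (σ * k) s
    rw [← hm] at hN
    have h1 := hk.le g hg1 ⟨hg, q₁, hq₁C, hgq₁⟩ m hmp
    have h2 : ⟪g, m⟫ = σ * k := by
      rw [hm, inner_add_right, inner_smul_right, inner_smul_right, hgg, hgp]; ring
    rw [h2] at h1
    rcases hk0.eq_or_lt with rfl | hk0
    · simpa [hm] using hmp
    · have h3 : σ ≤ ‖m‖ := by nlinarith
      have h4 : σ ^ 2 ≤ ‖m‖ ^ 2 := by gcongr
      have h5 : (σ ^ 2 - 1) * s ^ 2 ≤ 0 := by nlinarith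
      have h6 : σ ^ 2 - 1 ≤ 0 := by
        by_contra! h
        have := mul_pos h (pow_pos hs 2)
        linarith
      have h7 : σ = 1 := by nlinarith
      rwa [hm, h7, one_mul] at hmp
  -- A boundary direction `y = A • g + s • p` with `A > k` appears on the way out of the dual cone.
  -- The vector `g'` farthest from it is also within the diameter of `g` and of both diametral
  -- directions, which forces `‖y‖ ≥ A + (1 - k)`. But `‖y‖ ^ 2 = A ^ 2 + 1 - k ^ 2` is smaller than
  -- the square of that bound by `2 * (1 - k) * (A - k)`.
  · by_contra hb
    obtain ⟨t, ht0, ht1, hT⟩ := exists_touches_between hC.1 hmp hb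
    set A := ((1 - t) * σ + t) * k with hA
    have hy : (1 - t) • m + t • (k • g + s • (p : E3)) = A • g + s • (p : E3) := by
      rw [hm, hA]; module
    rw [hy] at hT
    have hσt : 1 ≤ (1 - t) * σ + t := by nlinarith
    have hAk : k ≤ A := by rw [hA]; nlinarith
    rcases hAk.eq_or_lt with hAk | hAk
    · rw [← hAk] at hT
      exact hb hT.1
    have hN := norm_smul_add_smul_sq hg1 (norm_coe p) hgp A s
    set y := A • g + s • (p : E3) with hydef
    have hA0 : 0 < A := hk0.trans hAk
    have hn : 0 < ‖y‖ := by
      by_contra! h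
      have := le_antisymm h (norm_nonneg _)
      rw [this] at hN
      linarith [pow_pos hA0 2, pow_pos hs 2]
    obtain ⟨g', hg', hg'1, hyg'⟩ := hk.exists_eq (‖y‖⁻¹ • y)
      (by rw [norm_smul, norm_inv, norm_norm, inv_mul_cancel₀ hn.ne'])
      (hT.smul (inv_nonneg.mpr hn.le))
    rw [real_inner_smul_left, inv_mul_eq_iff_eq_mul₀ hn.ne'] at hyg'
    have hyg : ⟪y, g'⟫ = A * ⟪g, g'⟫ + s * ⟪(p : E3), g'⟫ := by
      rw [hydef, inner_add_left, real_inner_smul_left, real_inner_smul_left]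
    rw [hyg'] at hyg
    set c := ⟪g, g'⟫ with hc
    have hkc : k ≤ c := by
      simpa [hg'1] using hk.le g hg1 ⟨hg, q₁, hq₁C, hgq₁⟩ g' hg'
    have hc1 : c ≤ 1 := by
      simpa [hg1, hg'1] using real_inner_le_norm g g'
    have hdiam : ∀ q : S2, q ∈ C → ⟪g, (q : E3)⟫ = 0 → k • g + s • (q : E3) ∈ polar C →
        k * (1 - c) ≤ s * ⟪(q : E3), g'⟫ := fun q hqC hgq hkq => by
      have hn1 : ‖k • g + s • (q : E3)‖ = 1 := by
        have := norm_smul_add_smul_sq hg1 (norm_coe q) hgq k s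
        rw [hks] at this
        exact (pow_eq_one_iff_of_nonneg (norm_nonneg _) two_ne_zero).mp this
      have hmin := hk.le g hg1 ⟨hg, q₁, hq₁C, hgq₁⟩
      have hkk : ⟪g, k • g + s • (q : E3)⟫ = k := by
        rw [inner_add_right, inner_smul_right, inner_smul_right, hgg, hgq]; ring
      have hth : Touches C (k • g + s • (q : E3)) :=
        touches_of_farthest hC.1 hC.2.1 hg1 hn1 hkq (by rw [hkk]; exact hmin)
          (by rw [hkk]; linarith [pow_pos hs 2])
      have h1 := hk.le _ hn1 hth g' hg'
      rw [hg'1, mul_one, inner_add_left, real_inner_smul_left, real_inner_smul_left, ← hc] at h1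
      linarith
    have h1 := hdiam q₁ hq₁C hgq₁ hkq₁
    have h2 := hdiam q₂ hq₂C hgq₂ hkq₂
    have hpq : ⟪(p : E3), g'⟫ = α * ⟪(q₁ : E3), g'⟫ + β * ⟪(q₂ : E3), g'⟫ := by
      rw [e, inner_add_left, real_inner_smul_left, real_inner_smul_left]
    have hkc0 : 0 ≤ k * (1 - c) := mul_nonneg hk0.le (sub_nonneg.mpr hc1)
    have h3 : k * (1 - c) ≤ s * ⟪(p : E3), g'⟫ := by
      have h31 := mul_le_mul_of_nonneg_left h1 hα
      have h32 := mul_le_mul_of_nonneg_left h2 hβ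
      have h33 : k * (1 - c) ≤ σ * (k * (1 - c)) := le_mul_of_one_le_left hkc0 hσ
      rw [hpq]
      rw [hσdef] at h33
      linarith
    have hk1 : k < 1 := (sq_lt_one_iff₀ hk0.le).mp (by linarith [pow_pos hs 2])
    have h4 : A * k + k * (1 - k) ≤ ‖y‖ * k := by
      have := mul_nonneg (sub_nonneg.mpr hAk.le) (sub_nonneg.mpr hkc)
      linarith
    have h5 : A + (1 - k) ≤ ‖y‖ := by
      by_contra! h
      have := mul_lt_mul_of_pos_right h hk0
      linarith
    have h6 : (A + (1 - k)) ^ 2 ≤ ‖y‖ ^ 2 := by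
      have : 0 ≤ A + (1 - k) := by linarith
      gcongr
    have h7 : 0 < (1 - k) * (A - k) := mul_pos (by linarith) (by linarith)
    linarith

lemma HasDualDiameter.convex_rays_diametral {C : Set S2} (hC : IsConvexBody C) {k s : ℝ}
    (hk : HasDualDiameter C k) (hs : 0 < s) (hks : k ^ 2 + s ^ 2 = 1) {g : E3}
    (hg1 : ‖g‖ = 1) (hg : g ∈ polar C) : Convex ℝ (rays (diametral C k s g)) := by
  refine convex_rays fun a ha b hb x y hx hy => ?_
  have h0 := hC.2.1.add_ne_zero ha.1 hb.1 hx hy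
  set z := x • (a : E3) + y • (b : E3) with hz
  have hn : 0 < ‖z‖ := norm_pos_iff.mpr h0
  have e : (normalize z h0 : E3) = (‖z‖⁻¹ * x) • (a : E3) + (‖z‖⁻¹ * y) • (b : E3) := by
    change ‖z‖⁻¹ • z = _
    rw [mul_smul, mul_smul, ← smul_add]
  have hx' : 0 ≤ ‖z‖⁻¹ * x := by positivity
  have hy' : 0 ≤ ‖z‖⁻¹ * y := by positivity
  refine ⟨‖z‖, hn, normalize z h0, ⟨hC.2.1.2 a ha.1 b hb.1 ⟨_, _, hx', hy', e⟩, ?_,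
    hk.mem_polar_of_between hC hs hks hg1 hg ha hb hx' hy' e⟩, (norm_smul_normalize z h0).symm⟩
  rw [e, inner_add_right, inner_smul_right, inner_smul_right, ha.2.1, hb.2.1]
  ring

/-- The centers of all diametral lunes of `C`. -/
def diametralCenters (C : Set S2) (k s : ℝ) : Set S2 :=
  {q | ∃ g ∈ polar C, ‖g‖ = 1 ∧ q ∈ diametral C k s g}

/-- The set is a projection of a compact set of pairs `(g, q)`. Separation from a ray needs this
compactness. -/
lemma isClosed_diametralCenters {C : Set S2} (hC : IsClosed C) (k s : ℝ) :
    IsClosed (diametralCenters C k s) := by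
  have hK : IsCompact ((((polar C ∩ {v | ‖v‖ = 1}) ×ˢ C) ∩ {z : E3 × S2 | ⟪z.1, (z.2 : E3)⟫ = 0}) ∩
      (fun z : E3 × S2 => k • z.1 + s • (z.2 : E3)) ⁻¹' polar C) := by
    refine (((isCompact_unit_polar C).prod hC.isCompact).inter_right
      (isClosed_eq (by fun_prop) (by fun_prop))).inter_right ((isClosed_polar C).preimage ?_)
    fun_prop
  convert (hK.image continuous_snd).isClosed using 1
  ext q
  constructor
  · rintro ⟨g, hg, hg1, hqC, hgq, hkq⟩
    exact ⟨(g, q), ⟨⟨⟨⟨hg, hg1⟩, hqC⟩, hgq⟩, hkq⟩, rfl⟩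
  · rintro ⟨⟨g, q⟩, ⟨⟨⟨⟨hg, hg1⟩, hqC⟩, hgq⟩, hkq⟩, rfl⟩
    exact ⟨g, hg, hg1, hqC, hgq, hkq⟩

/-! ### Every boundary point is a center -/

/-- The cone over the centers of diametral lunes contains the whole convex body. -/
lemma HasDualDiameter.exists_smul_mem_convexHull {C : Set S2} (hC : IsConvexBody C) {k s : ℝ}
    (hk : HasDualDiameter C k) (hs : 0 < s) (hks : k ^ 2 + s ^ 2 = 1)
    (hne : ∃ g, ‖g‖ = 1 ∧ Touches C g) {p : S2} (hp : p ∈ C) :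
    ∃ r : ℝ, 0 ≤ r ∧
      r • (p : E3) ∈ convexHull ℝ ((fun x : S2 => (x : E3)) '' diametralCenters C k s) := by
  by_contra! h
  obtain ⟨v, hv, hvp⟩ := exists_inner_pos_of_disjoint_ray
    (isCompact_coe_image (isClosed_diametralCenters hC.1 k s)) (norm_coe p)
    (by rintro _ ⟨a, -, rfl⟩; exact norm_coe a) h
  obtain ⟨c, -, hc⟩ := hC.exists_inner_pos
  -- Since `t < 1`, the part of `c` keeps `y` strictly positive on all centers, whereas the boundary
  -- direction `y` has a center orthogonal to it.
  obtain ⟨t, ht0, ht1, hT⟩ := exists_touches_between hC.1 (fun x hx => (hc x hx).le)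
    (fun hv' : v ∈ polar C => hvp.not_ge (hv' p hp))
  set y := (1 - t) • c + t • v with hy
  have hpos : ∀ q ∈ diametralCenters C k s, 0 < ⟪y, (q : E3)⟫ := fun q hq => by
    have h1 := hc q (by obtain ⟨_, _, _, hq, _⟩ := hq; exact hq)
    have h2 := hv q ⟨q, hq, rfl⟩
    rw [hy, inner_add_left, real_inner_smul_left, real_inner_smul_left]
    have := mul_pos (sub_pos.mpr ht1) h1
    have := mul_nonneg ht0 h2.le
    linarith
  have hex : ∀ g, ‖g‖ = 1 → Touches C g → ∃ q ∈ diametralCenters C k s, ⟪g, (q : E3)⟫ = 0 :=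
    fun g hg1 hg => by
      obtain ⟨q, hq, hgq, hkq⟩ := hk.exists_mem hC.1 hC.2.1 hs hks hg1 hg
      exact ⟨q, ⟨g, hg.1, hg1, hq, hgq, hkq⟩, hgq⟩
  obtain ⟨g, hg1, hg⟩ := hne
  obtain ⟨q, hq, -⟩ := hex g hg1 hg
  have hn : 0 < ‖y‖ := norm_pos_iff.mpr fun h0 => by
    have := hpos q hq
    rw [h0, inner_zero_left] at this
    exact lt_irrefl _ this
  obtain ⟨q', hq', hyq'⟩ := hex (‖y‖⁻¹ • y)
    (by rw [norm_smul, norm_inv, norm_norm, inv_mul_cancel₀ hn.ne'])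
    (hT.smul (inv_nonneg.mpr hn.le))
  rw [real_inner_smul_left] at hyq'
  exact (mul_pos (inv_pos.mpr hn) (hpos q' hq')).ne' hyq'

/-- Every boundary point is the center of a diametral lune, with respect to every supporting
hemisphere at that point. -/
lemma HasDualDiameter.mem_diametral {C : Set S2} (hC : IsConvexBody C) {k s : ℝ}
    (hk : HasDualDiameter C k) (hs : 0 < s) (hks : k ^ 2 + s ^ 2 = 1) {g : E3}
    (hg1 : ‖g‖ = 1) (hg : g ∈ polar C) {p : S2} (hp : p ∈ C) (hgp : ⟪g, (p : E3)⟫ = 0) :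
    p ∈ diametral C k s g := by
  obtain ⟨r, hr, hmem⟩ := hk.exists_smul_mem_convexHull hC hs hks ⟨g, hg1, hg, p, hp, hgp⟩ hp
  have hT := hk.convex_rays_diametral hC hs hks hg1 hg
  have hT0 : ∀ y ∈ rays (diametral C k s g), ⟪g, y⟫ = 0 := by
    rintro _ ⟨t, -, q, hq, rfl⟩
    rw [inner_smul_right, hq.2.1, mul_zero]
  -- An open half-space together with a convex subset of its bounding plane is convex. It contains
  -- all centers, and a multiple of `p` in it must lie in the planar part.
  have hconv : Convex ℝ ({y : E3 | 0 < ⟪g, y⟫} ∪ rays (diametral C k s g)) := by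
    rw [convex_iff_forall_pos]
    rintro x hx y hy a b ha hb hab
    have hlin : ⟪g, a • x + b • y⟫ = a * ⟪g, x⟫ + b * ⟪g, y⟫ := by
      rw [inner_add_right, inner_smul_right, inner_smul_right]
    rcases hx with hx | hx <;> rcases hy with hy | hy
    · exact Or.inl (by rw [Set.mem_ofPred_eq] at *; rw [hlin]; positivity)
    · exact Or.inl (by rw [Set.mem_ofPred_eq] at *; rw [hlin, hT0 y hy, mul_zero, add_zero]; positivity)
    · exact Or.inl (by rw [Set.mem_ofPred_eq] at *; rw [hlin, hT0 x hx, mul_zero, zero_add]; positivity)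
    · exact Or.inr (hT hx hy ha.le hb.le hab)
  have hsub : (fun x : S2 => (x : E3)) '' diametralCenters C k s ⊆
      {y : E3 | 0 < ⟪g, y⟫} ∪ rays (diametral C k s g) := by
    rintro _ ⟨q, ⟨g₁, hg₁, hg₁1, hq⟩, rfl⟩
    rcases (hg q hq.1).eq_or_lt with h0 | h0
    · exact Or.inr (coe_mem_rays
        (hk.mem_diametral_of_normal hC hs hks hg1 hg hg₁1 hg₁ hq h0.symm))
    · exact Or.inl h0
  rcases convexHull_min hsub hconv hmem with h | h
  · rw [Set.mem_ofPred_eq, inner_smul_right, hgp, mul_zero] at h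
    exact absurd h (lt_irrefl _)
  · exact mem_of_coe_eq_smul hr h

/-! ### Lunes and widths in terms of the dual cone -/

lemma IsSemicircleCenter.of_eq {L : Lune} {p : S2} (h : p = L.center) :
    IsSemicircleCenter p L.semicircle := (L.isSemicircleCenter_iff p).mpr h

/-- The thickness of a lune is the supplement of the distance between the centers of its two
hemispheres. -/
lemma Lune.thickness_eq (L : Lune) :
    L.thickness = Real.pi - Real.arccos ⟪(L.g : E3), (L.h : E3)⟫ := by
  have hn1 : ‖L.dir‖ ^ 2 = 1 - ⟪(L.g : E3), (L.h : E3)⟫ ^ 2 :=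
    norm_sub_smul_sq (norm_coe L.g) (norm_coe L.h)
  have hn2 : ‖L.swap.dir‖ ^ 2 = 1 - ⟪(L.g : E3), (L.h : E3)⟫ ^ 2 := by
    rw [← real_inner_comm]
    exact norm_sub_smul_sq (norm_coe L.h) (norm_coe L.g)
  have hpos : 0 < ‖L.dir‖ := norm_pos_iff.mpr L.dir_ne_zero
  have hpos' : 0 < ‖L.swap.dir‖ := norm_pos_iff.mpr L.swap.dir_ne_zero
  have hnn : ‖L.swap.dir‖ = ‖L.dir‖ :=
    (sq_eq_sq₀ hpos'.le hpos.le).mp (hn2.trans hn1.symm)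
  have hin : ⟪L.dir, L.swap.dir⟫ = -⟪(L.g : E3), (L.h : E3)⟫ * ‖L.dir‖ ^ 2 := by
    rw [hn1]
    change ⟪(L.h : E3) - ⟪(L.g : E3), (L.h : E3)⟫ • (L.g : E3),
      (L.g : E3) - ⟪(L.h : E3), (L.g : E3)⟫ • (L.h : E3)⟫ = _
    simp only [inner_sub_left, inner_sub_right, inner_smul_right, real_inner_smul_left,
      inner_self_coe, real_inner_comm (L.g : E3) (L.h : E3)]
    ring
  rw [← Real.arccos_neg]
  change InnerProductGeometry.angle (‖L.dir‖⁻¹ • L.dir) (‖L.swap.dir‖⁻¹ • L.swap.dir) = _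
  rw [InnerProductGeometry.angle_smul_left_of_pos _ _ (inv_pos.mpr hpos),
    InnerProductGeometry.angle_smul_right_of_pos _ _ (inv_pos.mpr hpos'),
    InnerProductGeometry.angle, hin, hnn]
  congr 1
  field_simp

lemma subset_hemisphere_iff {C : Set S2} {m : S2} : C ⊆ hemisphere m ↔ (m : E3) ∈ polar C :=
  forall₂_congr fun x _ => sdist_le_pi_div_two_iff m x

lemma coe_ne_zero (x : S2) : (x : E3) ≠ 0 :=
  norm_ne_zero_iff.mp (by rw [norm_coe]; exact one_ne_zero)

lemma supports_iff {C : Set S2} (hC : IsClosed C) {m : S2} : Supports m C ↔ Touches C (m : E3) := by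
  constructor
  · rintro ⟨p, hp, hsub, hmp⟩
    exact ⟨subset_hemisphere_iff.mp hsub, p, hC.frontier_subset hp, hmp⟩
  · rintro ⟨h1, p, hp, hmp⟩
    exact ⟨p, mem_frontier_of_inner_eq_zero (coe_ne_zero m) h1 hp hmp,
      subset_hemisphere_iff.mpr h1, hmp⟩

/-- The width of `C` determined by a supporting hemisphere is determined by the greatest distance
from its center to the centers of all hemispheres that contain `C`. -/
lemma IsConvexBody.exists_width_eq {C : Set S2} (hC : IsConvexBody C) {g : S2}
    (hg : Touches C (g : E3)) : ∃ h : S2, Touches C (h : E3) ∧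
      (∀ v ∈ polar C, ⟪(g : E3), (h : E3)⟫ * ‖v‖ ≤ ⟪(g : E3), v⟫) ∧
      -1 < ⟪(g : E3), (h : E3)⟫ ∧ ⟪(g : E3), (h : E3)⟫ < 1 ∧
      width C g = Real.pi - Real.arccos ⟪(g : E3), (h : E3)⟫ := by
  obtain ⟨c, hc1, hc⟩ := hC.exists_inner_pos
  have hcp : c ∈ polar C := fun x hx => (hc x hx).le
  obtain ⟨h', hh, hh1, hmin⟩ := exists_farthest (g : E3) hcp hc1
  obtain ⟨h, rfl⟩ : ∃ h : S2, (h : E3) = h' := ⟨⟨h', by simpa using hh1⟩, rfl⟩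
  have hlt : ⟪(g : E3), (h : E3)⟫ < 1 := by
    have h1 : ⟪(g : E3), c⟫ < 1 := by
      refine inner_lt_one_iff_real_of_norm_eq_one (norm_coe g) hc1 |>.mpr ?_
      rintro rfl
      obtain ⟨x, hx, hgx⟩ := hg.2
      exact (hc x hx).ne' hgx
    have h2 := hmin c hcp
    rw [hc1, mul_one] at h2
    exact h2.trans_lt h1
  have hgt : -1 < ⟪(g : E3), (h : E3)⟫ := by
    have h1 : ⟪-(g : E3), (h : E3)⟫ < 1 := by
      refine inner_lt_one_iff_real_of_norm_eq_one (by rw [norm_neg, norm_coe]) hh1 |>.mpr ?_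
      intro e
      exact neg_notMem_polar hC.2.2 (coe_ne_zero g) hg.1 (e ▸ hh)
    rw [inner_neg_left] at h1
    linarith
  have hth : Touches C (h : E3) :=
    touches_of_farthest hC.1 hC.2.1 (norm_coe g) hh1 hh hmin (by nlinarith)
  refine ⟨h, hth, hmin, hgt, hlt, ?_⟩
  have hne : g ≠ h := by
    rintro rfl
    rw [inner_self_coe] at hlt
    exact lt_irrefl _ hlt
  have hne' : g ≠ -h := by
    rintro rfl
    rw [show ((-h : S2) : E3) = -(h : E3) from rfl, inner_neg_left, inner_self_coe] at hgt
    exact lt_irrefl _ hgt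
  -- The thickness increases with the product of the two hemisphere centers, so the farthest `h`
  -- attains the minimum.
  refine IsLeast.csInf_eq ⟨⟨⟨g, h, hne, hne'⟩, rfl, (supports_iff hC.1).mpr hth, ?_⟩, ?_⟩
  · rw [Lune.thickness_eq]
  · rintro _ ⟨L, rfl, hL, rfl⟩
    rw [Lune.thickness_eq]
    have h1 := hmin _ ((supports_iff hC.1).mp hL).1
    rw [norm_coe, mul_one] at h1
    linarith [Real.antitone_arccos h1]

/-- For a body of constant width the dual cone has constant angular diameter. -/
lemma IsOfConstantWidth.exists_hasDualDiameter {C : Set S2} (hC : IsConvexBody C)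
    (hw : IsOfConstantWidth C) {g₀ : S2} (hg₀ : Touches C (g₀ : E3)) :
    ∃ k : ℝ, -1 < k ∧ k < 1 ∧ HasDualDiameter C k ∧
      thickness C = Real.pi - Real.arccos k := by
  obtain ⟨h₀, -, -, hgt₀, hlt₀, hw₀⟩ := hC.exists_width_eq hg₀
  have hall : ∀ g : S2, Touches C (g : E3) → width C g = width C g₀ := fun g hg =>
    hw g g₀ ((supports_iff hC.1).mpr hg) ((supports_iff hC.1).mpr hg₀)
  have key : ∀ g : E3, ‖g‖ = 1 → Touches C g → ∃ h ∈ polar C, ‖h‖ = 1 ∧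
      ⟪g, h⟫ = ⟪(g₀ : E3), (h₀ : E3)⟫ ∧ ∀ v ∈ polar C, ⟪g, h⟫ * ‖v‖ ≤ ⟪g, v⟫ := by
    intro g' hg1 hg
    obtain ⟨g, rfl⟩ : ∃ g : S2, (g : E3) = g' := ⟨⟨g', by simpa using hg1⟩, rfl⟩
    obtain ⟨h, hh, hmin, hgt, hlt, hwg⟩ := hC.exists_width_eq hg
    refine ⟨h, hh.1, norm_coe h, ?_, hmin⟩
    have h1 := hall g hg
    rw [hwg, hw₀] at h1
    exact Real.arccos_injOn ⟨hgt.le, hlt.le⟩ ⟨hgt₀.le, hlt₀.le⟩ (by linarith)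
  refine ⟨_, hgt₀, hlt₀, ⟨fun g hg1 hg => ?_, fun g hg1 hg => ?_⟩, ?_⟩
  · obtain ⟨h, -, -, e, hmin⟩ := key g hg1 hg
    exact e ▸ hmin
  · obtain ⟨h, hh, hh1, e, -⟩ := key g hg1 hg
    exact ⟨h, hh, hh1, e⟩
  · have hset : {t : ℝ | ∃ k : S2, Supports k C ∧ t = width C k} = {width C g₀} := by
      ext t
      constructor
      · rintro ⟨g, hg, rfl⟩
        exact hall g ((supports_iff hC.1).mp hg)
      · rintro rfl
        exact ⟨g₀, (supports_iff hC.1).mpr hg₀, rfl⟩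
    rw [← hw₀, thickness, hset, csInf_singleton]

end SphericalConvex

theorem theorem7 (W : Set SphericalConvex.S2)
    (hW : SphericalConvex.IsConvexBody W)
    (hconst : SphericalConvex.IsOfConstantWidth W)
    (p : SphericalConvex.S2) (hp : p ∈ frontier W) :
    ∃ L : SphericalConvex.Lune,
      W ⊆ L.carrier ∧
      L.thickness = SphericalConvex.thickness W ∧
      (SphericalConvex.IsSemicircleCenter p L.semicircle ∨
        SphericalConvex.IsSemicircleCenter p L.swap.semicircle) := by
  open SphericalConvex in
  obtain ⟨g', hg, hg1, hgp⟩ := hW.exists_normal hp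
  obtain ⟨g, rfl⟩ : ∃ g : S2, (g : E3) = g' := ⟨⟨g', by simpa using hg1⟩, rfl⟩
  have hpW : p ∈ W := hW.1.frontier_subset hp
  obtain ⟨k, hk1, hk2, hk, hthick⟩ := hconst.exists_hasDualDiameter hW ⟨hg, p, hpW, hgp⟩
  have hpos : 0 < 1 - k ^ 2 := by nlinarith
  set s := Real.sqrt (1 - k ^ 2)
  have hs : 0 < s := Real.sqrt_pos.mpr hpos
  have hks : k ^ 2 + s ^ 2 = 1 := by rw [Real.sq_sqrt hpos.le]; ring
  obtain ⟨-, -, hh⟩ := hk.mem_diametral hW hs hks hg1 hg hpW hgp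
  have hn : ‖k • (g : E3) + s • (p : E3)‖ = 1 := by
    have := norm_smul_add_smul_sq hg1 (norm_coe p) hgp k s
    rw [hks] at this
    exact (pow_eq_one_iff_of_nonneg (norm_nonneg _) two_ne_zero).mp this
  -- The component of this `h` orthogonal to `g` is `s • p`, which makes `p` the center of the
  -- semicircle on the great circle of `g`.
  obtain ⟨h, hhe⟩ : ∃ h : S2, (h : E3) = k • (g : E3) + s • (p : E3) :=
    ⟨⟨_, by simpa using hn⟩, rfl⟩
  rw [← hhe] at hh
  have hgh : ⟪(g : E3), (h : E3)⟫ = k := by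
    rw [hhe, inner_add_right, inner_smul_right, inner_smul_right, hgp, inner_self_coe]; ring
  have hne : g ≠ h := by
    rintro rfl
    rw [inner_self_coe] at hgh
    exact hk2.ne' hgh
  have hne' : g ≠ -h := by
    rintro rfl
    rw [show ((-h : S2) : E3) = -(h : E3) from rfl, inner_neg_left, inner_self_coe] at hgh
    exact hk1.ne hgh
  refine ⟨⟨g, h, hne, hne'⟩, Set.subset_inter (subset_hemisphere_iff.mpr hg)
    (subset_hemisphere_iff.mpr hh), ?_, Or.inl (IsSemicircleCenter.of_eq (Subtype.ext ?_))⟩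
  · rw [Lune.thickness_eq, hthick, hgh]
  · have hd : Lune.dir ⟨g, h, hne, hne'⟩ = s • (p : E3) := by
      change (h : E3) - ⟪(g : E3), (h : E3)⟫ • (g : E3) = _
      rw [hgh, hhe, add_sub_cancel_left]
    change (p : E3) = ‖Lune.dir _‖⁻¹ • Lune.dir _
    rw [hd, norm_smul, norm_coe, mul_one, Real.norm_of_nonneg hs.le, smul_smul,
      inv_mul_cancel₀ hs.ne', one_smul]
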